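/- Let $\mathbb T^d=\mathbb R^d/\mathbb Z^d$, let $A=(a_{ij}):\mathbb T^d\to\mathbb R^{d\times d}$ be a measurable matrix-valued function that is uniformly elliptic, i.e. there are $\theta_0,\theta_1>0$ with $$\theta_0|z|^2\le zA(x)z^T\le\theta_1|z|^2\qquad\text{for all }(x,z)\in\mathbb T^d\times\mathbb R^d,$$ let $V:\mathbb T^d\to\mathbb R$ be continuous, let $\overline H\in\mathbb R$, and let $g:\mathbb R\to\mathbb R$ be locally Lipschitz and such that, for some constant $C_g>0$, $$g(s)\,\mathrm{sign}(s)\ge C_g|s|-\frac1{C_g}\qquad\text{for all }s\in\mathbb R.$$ For $\varepsilon>0$ set $$H_\varepsilon(x,p)=\frac{pA(x)p^T}{2+\varepsilon|pA(x)p^T|},\qquad (x,p)\in\mathbb T^d\times\mathbb R^d .$$ Then there is a constant $C_\infty\ge 0$, which does not depend on $\varepsilon$, such that for every $\varepsilon>0$ every solution $u_\varepsilon$ of $$-\operatorname{div}(A\,Du_\varepsilon^T)+H_\varepsilon(x,Du_\varepsilon)+V(x)-\overline H-g(-u_\varepsilon)=0\qquad\text{in }\mathbb T^d$$ satisfies $\|u_\varepsilon\|_{L^\infty(\mathbb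 T^d)}\le C_\infty$. Here a solution is a function $u_\varepsilon\in H^1(\mathbb T^d)$ with $A\,Du_\varepsilon^T\in L^2(\mathbb T^d)$ and $g(-u_\varepsilon)\in L^1(\mathbb T^d)$ that satisfies the equation in the sense of distributions, i.e. $$\int_{\mathbb T^d}D\varphi\,A\,Du_\varepsilon^T+\bigl(H_\varepsilon(x,Du_\varepsilon)+V(x)-\overline H-g(-u_\varepsilon)\bigr)\varphi\,dx=0\qquad\text{for all }\varphi\in C^\infty(\mathbb T^d).$$ (The condition $A\,Du_\varepsilon^T\in L^2$ is automatic when $A$ has bounded entries, in particular when $A$ is symmetric; the condition $g(-u_\varepsilon)\in L^1$ is automatic when $u_\varepsilon\in L^\infty(\mathbb T^d)$.) -/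

import Mathlib

open MeasureTheory
open scoped Matrix ContDiff NNReal

noncomputable section

namespace EllipticTorus

/-- The covering map `ℝ^d → 𝕋^d = ℝ^d / ℤ^d`. -/
def proj {d : ℕ} (y : Fin d → ℝ) : UnitAddTorus (Fin d) := fun i => (y i : UnitAddCircle)

/-- A real function on the torus is smooth if its periodic lift to `ℝ^d` is `C^∞`. -/
def IsSmooth {d : ℕ} (f : UnitAddTorus (Fin d) → ℝ) : Prop :=
  ContDiff ℝ ∞ (fun y : Fin d → ℝ => f (proj y))

/-- The `i`-th classical partial derivative of a function on the torus. -/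
def partialDeriv {d : ℕ} (i : Fin d) (f : UnitAddTorus (Fin d) → ℝ)
    (x : UnitAddTorus (Fin d)) : ℝ :=
  deriv (fun t : ℝ => f (x + proj (Pi.single i t))) 0

/-- The classical gradient of a function on the torus. -/
def gradient {d : ℕ} (f : UnitAddTorus (Fin d) → ℝ) (x : UnitAddTorus (Fin d)) : Fin d → ℝ :=
  fun i => partialDeriv i f x

/-- `u ∈ H^1(𝕋^d)` with weak gradient `Du`: both are square integrable, and
`∫ u ∂ᵢφ = - ∫ (Du)ᵢ φ` for all smooth `φ` on the torus.
The weak gradient is determined by `u` up to a null set. -/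
structure IsSobolevH1 {d : ℕ} (u : UnitAddTorus (Fin d) → ℝ)
    (Du : UnitAddTorus (Fin d) → Fin d → ℝ) : Prop where
  memLp : MemLp u 2 volume
  memLp_grad : ∀ i, MemLp (fun x => Du x i) 2 volume
  integral_eq : ∀ (i : Fin d) (φ : UnitAddTorus (Fin d) → ℝ), IsSmooth φ →
    ∫ x, u x * partialDeriv i φ x = - ∫ x, Du x i * φ x

/-- Uniform ellipticity: there are `θ₀, θ₁ > 0` with `θ₀ |z|² ≤ z A(x) zᵀ ≤ θ₁ |z|²` for all
`x` and `z`, where `|z|² = z ⬝ᵥ z` is the squared Euclidean norm. -/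
def UniformlyElliptic {d : ℕ} (A : UnitAddTorus (Fin d) → Matrix (Fin d) (Fin d) ℝ) : Prop :=
  ∃ θ₀ θ₁ : ℝ, 0 < θ₀ ∧ 0 < θ₁ ∧ ∀ (x : UnitAddTorus (Fin d)) (z : Fin d → ℝ),
    θ₀ * (z ⬝ᵥ z) ≤ z ⬝ᵥ (A x *ᵥ z) ∧ z ⬝ᵥ (A x *ᵥ z) ≤ θ₁ * (z ⬝ᵥ z)

/-- The coupling `g` is locally Lipschitz and `g(s) sign(s) ≥ C_g |s| - 1 / C_g` for some
constant `C_g > 0`. -/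
def CouplingAssumption (g : ℝ → ℝ) : Prop :=
  LocallyLipschitz g ∧ ∃ Cg : ℝ, 0 < Cg ∧ ∀ s : ℝ, Cg * |s| - 1 / Cg ≤ g s * Real.sign s

/-- The truncated Hamiltonian `H_ε(x, p) = p A pᵀ / (2 + ε |p A pᵀ|)`. -/
def Heps {d : ℕ} (A : UnitAddTorus (Fin d) → Matrix (Fin d) (Fin d) ℝ) (ε : ℝ)
    (x : UnitAddTorus (Fin d)) (p : Fin d → ℝ) : ℝ :=
  (p ⬝ᵥ (A x *ᵥ p)) / (2 + ε * |p ⬝ᵥ (A x *ᵥ p)|)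

/-- `u ∈ H^1(𝕋^d)` solves `- div (A Duᵀ) + H_ε(x, Du) + V(x) - Hbar - g(-u) = 0` in the sense of
distributions on the torus. The conditions `A Duᵀ ∈ L²` and `g(-u) ∈ L¹` say that the terms of
the equation are defined: the first is automatic when `A` has bounded measurable entries (for
instance when it is measurable, symmetric and uniformly elliptic), the second is automatic when
`g` is continuous and `u` is essentially bounded. -/
def IsWeakSolution {d : ℕ} (A : UnitAddTorus (Fin d) → Matrix (Fin d) (Fin d) ℝ)
    (V : UnitAddTorus (Fin d) → ℝ) (g : ℝ → ℝ) (Hbar ε : ℝ)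
    (u : UnitAddTorus (Fin d) → ℝ) : Prop :=
  ∃ Du : UnitAddTorus (Fin d) → Fin d → ℝ,
    IsSobolevH1 u Du ∧
    (∀ i, MemLp (fun x => (A x *ᵥ Du x) i) 2 volume) ∧
    Integrable (fun x => g (-u x)) volume ∧
    ∀ φ : UnitAddTorus (Fin d) → ℝ, IsSmooth φ →
      ∫ x, (gradient φ x ⬝ᵥ (A x *ᵥ Du x) +
        (Heps A ε x (Du x) + (V x - Hbar) - g (-u x)) * φ x) = 0

end EllipticTorus

end

noncomputable section

namespace EllipticTorus

open Filter Topology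

/-! Both bounds come from testing the equation with a bounded, smooth, nondecreasing function of
`u`, chosen so that the resulting integrand dominates a nonnegative function vanishing only where
the bound holds. Since the integral is zero, that function vanishes almost everywhere.

For the upper bound (`IsWeakSolution.ae_le`), `H_ε ≥ 0` has the favourable sign, and the growth of
`g` does the rest. For the lower bound (`IsWeakSolution.neg_le_ae`) `H_ε` has the wrong sign. Since
`H_ε ≤ pApᵀ / 2`, the diffusion term absorbs it wherever `ψ' ≥ ψ / 2`; this forces exponential
growth, which a bounded `ψ` can sustain only up to some level `M`. Beyond `M` the bound `H_ε ≤ ε⁻¹`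
is used instead, and `g` beats it once `M` is large. Only `M` depends on `ε`; the level `k` in the
conclusion does not.

Such test functions are admissible by `IsSobolevH1.integral_test_comp`, where Fourier partial sums
of `u` replace `u`. -/

/-! ### Fourier approximation in `H^1` of the torus. -/

theorem pi_haarAddCircle (d : ℕ) :
    Measure.pi (fun _ : Fin d => (AddCircle.haarAddCircle : Measure UnitAddCircle)) =
      (volume : Measure (UnitAddTorus (Fin d))) := by
  rw [volume_pi]
  congr 1
  ext1 i
  simp [AddCircle.volume_eq_smul_haarAddCircle]

instance isProbabilityMeasure_volume (d : ℕ) :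
    IsProbabilityMeasure (volume : Measure (UnitAddTorus (Fin d))) := by
  rw [← pi_haarAddCircle]
  infer_instance

/-- The Fourier coefficients with respect to the volume of the torus. -/
def coeff {d : ℕ} (f : UnitAddTorus (Fin d) → ℝ) (n : Fin d → ℤ) : ℂ :=
  ∫ y, UnitAddTorus.mFourier (-n) y * (f y : ℂ)

theorem tendsto_eLpNorm_mFourier_sum_haar {d : ℕ} (f : UnitAddTorus (Fin d) → ℂ)
    (hf : MemLp f 2 (Measure.pi fun _ => AddCircle.haarAddCircle)) :
    Tendsto (fun s : Finset (Fin d → ℤ) => eLpNorm (fun x => ∑ n ∈ s,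
      (∫ y, UnitAddTorus.mFourier (-n) y * f y ∂(Measure.pi fun _ => AddCircle.haarAddCircle)) *
        UnitAddTorus.mFourier n x - f x) 2 (Measure.pi fun _ => AddCircle.haarAddCircle))
      atTop (𝓝 0) := by
  have h := UnitAddTorus.hasSum_mFourier_series_L2 (hf.toLp f)
  have h' := (Lp.tendsto_Lp_iff_tendsto_eLpNorm _ _ hf).1 h
  have hc : ∀ n, UnitAddTorus.mFourierCoeff (hf.toLp f) n =
      ∫ y, UnitAddTorus.mFourier (-n) y * f y
        ∂(Measure.pi fun _ => AddCircle.haarAddCircle) := by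
    intro n
    refine integral_congr_ae ?_
    filter_upwards [hf.coeFn_toLp] with y hy
    rw [hy, smul_eq_mul]
  refine h'.congr fun s => eLpNorm_congr_ae ?_
  simp only [← map_smul, ← map_sum, hc]
  filter_upwards [ContinuousMap.coeFn_toLp (p := 2) (𝕜 := ℂ)
    (Measure.pi fun _ => AddCircle.haarAddCircle) (∑ n ∈ s,
      (∫ y, UnitAddTorus.mFourier (-n) y * f y ∂(Measure.pi fun _ => AddCircle.haarAddCircle)) •
        UnitAddTorus.mFourier n)] with x hx
  refine (congrArg (· - f x) hx).trans ?_
  simp [ContinuousMap.sum_apply]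

/-- A real trigonometric polynomial. -/
def trigPoly {d : ℕ} (s : Finset (Fin d → ℤ)) (c : (Fin d → ℤ) → ℂ)
    (x : UnitAddTorus (Fin d)) : ℝ :=
  (∑ n ∈ s, c n * UnitAddTorus.mFourier n x).re

/-- The Fourier multiplier of the `i`-th partial derivative. -/
def derivSymbol {d : ℕ} (i : Fin d) (n : Fin d → ℤ) : ℂ := 2 * Real.pi * Complex.I * n i

theorem continuous_trigPoly {d : ℕ} (s : Finset (Fin d → ℤ)) (c : (Fin d → ℤ) → ℂ) :
    Continuous (trigPoly s c) := by
  unfold trigPoly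
  fun_prop

theorem memLp_trigPoly {d : ℕ} (s : Finset (Fin d → ℤ)) (c : (Fin d → ℤ) → ℂ) :
    MemLp (trigPoly s c) 2 volume := by
  have h := ContinuousMap.memLp (p := 2) (volume : Measure (UnitAddTorus (Fin d))) ℝ
    (⟨trigPoly s c, continuous_trigPoly s c⟩ : C(UnitAddTorus (Fin d), ℝ))
  exact h

theorem mFourier_proj {d : ℕ} (n : Fin d → ℤ) (y : Fin d → ℝ) :
    UnitAddTorus.mFourier n (proj y) =
      ∏ j, Complex.exp (2 * Real.pi * Complex.I * n j * y j) := by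
  change ∏ j, fourier (n j) (proj y j) = _
  refine Finset.prod_congr rfl fun j _ => ?_
  simp [proj]

theorem mFourier_add_arg {d : ℕ} (n : Fin d → ℤ) (x y : UnitAddTorus (Fin d)) :
    UnitAddTorus.mFourier n (x + y) =
      UnitAddTorus.mFourier n x * UnitAddTorus.mFourier n y := by
  simp [UnitAddTorus.mFourier, fourier_apply, smul_add, AddCircle.toCircle_add,
    Finset.prod_mul_distrib]

theorem mFourier_proj_single {d : ℕ} (n : Fin d → ℤ) (i : Fin d) (t : ℝ) :
    UnitAddTorus.mFourier n (proj (Pi.single i t)) = Complex.exp (derivSymbol i n * t) := by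
  rw [mFourier_proj, Finset.prod_eq_single i]
  · simp [derivSymbol]
  · intro j _ hj
    simp [Pi.single_eq_of_ne hj]
  · simp

theorem isSmooth_trigPoly {d : ℕ} (s : Finset (Fin d → ℤ)) (c : (Fin d → ℤ) → ℂ) :
    IsSmooth (trigPoly s c) := by
  unfold IsSmooth trigPoly
  simp only [mFourier_proj]
  refine Complex.reCLM.contDiff.comp (ContDiff.sum fun n _ => contDiff_const.mul
    (contDiff_prod fun j _ => ContDiff.cexp (contDiff_const.mul ?_)))
  exact Complex.ofRealCLM.contDiff.comp (contDiff_apply ℝ ℝ j)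

theorem hasDerivAt_trigPoly {d : ℕ} (s : Finset (Fin d → ℤ)) (c : (Fin d → ℤ) → ℂ)
    (i : Fin d) (x : UnitAddTorus (Fin d)) :
    HasDerivAt (fun t : ℝ => trigPoly s c (x + proj (Pi.single i t)))
      (trigPoly s (fun n => derivSymbol i n * c n) x) 0 := by
  have h : HasDerivAt (fun t : ℝ => ∑ n ∈ s, c n * UnitAddTorus.mFourier n
      (x + proj (Pi.single i t)))
      (∑ n ∈ s, derivSymbol i n * c n * UnitAddTorus.mFourier n x) 0 := by
    refine HasDerivAt.fun_sum fun n _ => ?_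
    simp only [mFourier_add_arg, mFourier_proj_single]
    have h1 : HasDerivAt (fun t : ℝ => Complex.exp (derivSymbol i n * t))
        (derivSymbol i n) 0 := by
      have h2 : HasDerivAt (fun t : ℝ => derivSymbol i n * (t : ℂ)) (derivSymbol i n) 0 := by
        simpa using (Complex.ofRealCLM.hasDerivAt (x := (0 : ℝ))).const_mul (derivSymbol i n)
      simpa using h2.cexp
    convert! (h1.const_mul (UnitAddTorus.mFourier n x)).const_mul (c n) using 1
    ring
  exact Complex.reCLM.hasFDerivAt.comp_hasDerivAt (0 : ℝ) h

theorem partialDeriv_trigPoly {d : ℕ} (s : Finset (Fin d → ℤ)) (c : (Fin d → ℤ) → ℂ)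
    (i : Fin d) :
    partialDeriv i (trigPoly s c) = trigPoly s (fun n => derivSymbol i n * c n) :=
  funext fun x => (hasDerivAt_trigPoly s c i x).deriv

theorem tendsto_eLpNorm_trigPoly {d : ℕ} {f : UnitAddTorus (Fin d) → ℝ}
    (hf : MemLp f 2 volume) :
    Tendsto (fun s => eLpNorm (fun x => trigPoly s (coeff f) x - f x) 2 volume)
      atTop (𝓝 0) := by
  have h := tendsto_eLpNorm_mFourier_sum_haar (fun x => (f x : ℂ))
    (by rw [pi_haarAddCircle]; exact hf.ofReal)
  rw [pi_haarAddCircle] at h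
  refine tendsto_of_tendsto_of_tendsto_of_le_of_le tendsto_const_nhds h
    (fun _ => zero_le) fun s => eLpNorm_mono fun x => ?_
  refine le_trans (le_of_eq ?_) (Complex.abs_re_le_norm _)
  simp [trigPoly, coeff]

theorem integral_mul_trigPoly_singleton {d : ℕ} {f : UnitAddTorus (Fin d) → ℝ}
    (hf : MemLp f 2 volume) (n : Fin d → ℤ) (c : (Fin d → ℤ) → ℂ) :
    ∫ x, f x * trigPoly {-n} c x = (c (-n) * coeff f n).re := by
  have hi : Integrable (fun y => UnitAddTorus.mFourier (-n) y * (f y : ℂ)) := by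
    refine (hf.ofReal.integrable one_le_two).bdd_mul (c := 1)
      (ContinuousMap.continuous _).aestronglyMeasurable (ae_of_all _ fun x => ?_)
    exact (ContinuousMap.norm_coe_le_norm _ x).trans UnitAddTorus.mFourier_norm.le
  rw [coeff, ← integral_const_mul]
  refine Eq.trans ?_ (integral_re (hi.const_mul (c (-n))))
  refine integral_congr_ae (ae_of_all _ fun x => ?_)
  have : c (-n) * (UnitAddTorus.mFourier (-n) x * (f x : ℂ)) =
    (f x : ℂ) * (c (-n) * UnitAddTorus.mFourier (-n) x) := by ring
  simp only [trigPoly, Finset.sum_singleton, this, RCLike.re_eq_complex_re,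
    Complex.re_ofReal_mul]

/-- Testing the weak derivative with a single frequency. It makes the partial sums of `Du` the
derivatives of those of `u`. -/
theorem IsSobolevH1.coeff_grad {d : ℕ} {u : UnitAddTorus (Fin d) → ℝ}
    {Du : UnitAddTorus (Fin d) → Fin d → ℝ} (h : IsSobolevH1 u Du) (i : Fin d) :
    coeff (fun x => Du x i) = fun n => derivSymbol i n * coeff u n := by
  funext n
  have key : ∀ c : ℂ, (-(derivSymbol i n * c * coeff u n)).re =
      -(c * coeff (fun x => Du x i) n).re := by
    intro c
    have h1 := h.integral_eq i _ (isSmooth_trigPoly {-n} fun _ => c)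
    rw [partialDeriv_trigPoly, integral_mul_trigPoly_singleton h.memLp,
      integral_mul_trigPoly_singleton (h.memLp_grad i)] at h1
    rw [← h1]
    congr 1
    simp [derivSymbol]
  -- The factors `1` and `i` recover the real and imaginary parts.
  have h1 := key 1
  have h2 := key Complex.I
  apply Complex.ext
  · simp at h1 ⊢
    linarith
  · simp [mul_assoc, mul_left_comm (derivSymbol i n)] at h2 ⊢
    linarith

/-- Functions in `H^1` are approximated by smooth ones. -/
theorem IsSobolevH1.exists_smooth_approx {d : ℕ} {u : UnitAddTorus (Fin d) → ℝ}
    {Du : UnitAddTorus (Fin d) → Fin d → ℝ} (h : IsSobolevH1 u Du) :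
    ∃ s : ℕ → Finset (Fin d → ℤ),
      (∀ᵐ x, Tendsto (fun k => trigPoly (s k) (coeff u) x) atTop (𝓝 (u x))) ∧
      ∀ i, Tendsto (fun k => eLpNorm
        (fun x => partialDeriv i (trigPoly (s k) (coeff u)) x - Du x i) 2 volume)
        atTop (𝓝 0) := by
  -- Pointwise convergence needs a subsequence; the derivatives still converge in `L²` along it.
  have h1 := tendstoInMeasure_of_tendsto_eLpNorm (p := 2) (by norm_num)
    (fun s => (memLp_trigPoly s (coeff u)).1) h.memLp.1 (tendsto_eLpNorm_trigPoly h.memLp)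
  obtain ⟨s, hs, hs'⟩ := h1.exists_seq_tendsto_ae'
  refine ⟨s, hs', fun i => ?_⟩
  have h2 := (tendsto_eLpNorm_trigPoly (h.memLp_grad i)).comp hs
  rw [h.coeff_grad i] at h2
  simp only [partialDeriv_trigPoly]
  exact h2

/-! ### Nonlinear test functions of a Sobolev function. -/

/-- Controls the error `Ψ'(v_k) (∂ᵢv_k - (Du)ᵢ) Gᵢ` made by replacing `∂ᵢv_k` with `(Du)ᵢ`. -/
theorem tendsto_integral_mul_mul_zero {X : Type*} [MeasurableSpace X] {μ : Measure X}
    {p w : ℕ → X → ℝ} {G : X → ℝ} {K : ℝ} (hp : ∀ k, AEStronglyMeasurable (p k) μ)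
    (hpK : ∀ k x, |p k x| ≤ K) (hw : ∀ k, MemLp (w k) 2 μ)
    (hw0 : Tendsto (fun k => eLpNorm (w k) 2 μ) atTop (𝓝 0)) (hG : MemLp G 2 μ) :
    (∀ k, Integrable (fun x => p k x * (w k x * G x)) μ) ∧
    Tendsto (fun k => ∫ x, p k x * (w k x * G x) ∂μ) atTop (𝓝 0) := by
  have hint : ∀ k, Integrable (fun x => p k x * (w k x * G x)) μ := fun k =>
    ((hw k).integrable_mul hG).bdd_mul (hp k) (ae_of_all _ (hpK k))
  refine ⟨hint, ?_⟩
  have h := tendsto_integral_of_L1' (μ := μ) (fun _ : X => (0 : ℝ)) aestronglyMeasurable_const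
    (F := fun k x => p k x * (w k x * G x)) (l := atTop) (Eventually.of_forall hint) ?_
  · simpa using h
  have hb : Tendsto (fun k => ENNReal.ofReal K * (eLpNorm (w k) 2 μ * eLpNorm G 2 μ)) atTop
      (𝓝 0) := by
    have h1 := ENNReal.Tendsto.mul_const (b := eLpNorm G 2 μ) hw0 (Or.inr hG.2.ne)
    have h2 := ENNReal.Tendsto.const_mul (a := ENNReal.ofReal K) h1 (Or.inr ENNReal.ofReal_ne_top)
    simpa using h2
  refine tendsto_of_tendsto_of_tendsto_of_le_of_le tendsto_const_nhds hb (fun _ => zero_le)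
    fun k => ?_
  calc eLpNorm ((fun x => p k x * (w k x * G x)) - fun _ => (0 : ℝ)) 1 μ
      ≤ ENNReal.ofReal K * eLpNorm (w k • G) 1 μ := by
        refine eLpNorm_le_mul_eLpNorm_of_ae_le_mul (ae_of_all _ fun x => ?_) _
        simp only [Pi.sub_apply, sub_zero, Pi.smul_apply', smul_eq_mul]
        rw [norm_mul]
        exact mul_le_mul_of_nonneg_right (hpK k x) (norm_nonneg _)
    _ ≤ _ := by
        gcongr
        exact eLpNorm_smul_le_mul_eLpNorm hG.1 (hw k).1

theorem gradient_comp_trigPoly {d : ℕ} {Ψ : ℝ → ℝ} (hΨ : Differentiable ℝ Ψ)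
    (s : Finset (Fin d → ℤ)) (c : (Fin d → ℤ) → ℂ) (x : UnitAddTorus (Fin d)) (i : Fin d) :
    gradient (fun y => Ψ (trigPoly s c y)) x i =
      deriv Ψ (trigPoly s c x) * partialDeriv i (trigPoly s c) x := by
  have h0 : trigPoly s c (x + proj (Pi.single i (0 : ℝ))) = trigPoly s c x := by
    congr 1
    ext j
    simp [proj]
  have h1 := hasDerivAt_trigPoly s c i x
  have h2 := (hΨ (trigPoly s c (x + proj (Pi.single i (0 : ℝ))))).hasDerivAt.comp (0 : ℝ) h1
  rw [h0] at h2
  rw [partialDeriv_trigPoly]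
  exact h2.deriv

/-- A distributional identity with an `L²` flux and an `L¹` source may be tested with bounded
smooth functions of an `H^1` function. -/
theorem IsSobolevH1.integral_test_comp {d : ℕ} {u : UnitAddTorus (Fin d) → ℝ}
    {Du : UnitAddTorus (Fin d) → Fin d → ℝ} (h : IsSobolevH1 u Du)
    {G : UnitAddTorus (Fin d) → Fin d → ℝ} (hG : ∀ i, MemLp (fun x => G x i) 2 volume)
    {F : UnitAddTorus (Fin d) → ℝ} (hF : Integrable F volume)
    (heq : ∀ φ : UnitAddTorus (Fin d) → ℝ, IsSmooth φ →
      ∫ x, (gradient φ x ⬝ᵥ G x + F x * φ x) = 0)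
    {Ψ : ℝ → ℝ} {K : ℝ} (hΨ : ContDiff ℝ ∞ Ψ) (hK : ∀ s, |Ψ s| ≤ K)
    (hK' : ∀ s, |deriv Ψ s| ≤ K) :
    Integrable (fun x => deriv Ψ (u x) * (Du x ⬝ᵥ G x) + F x * Ψ (u x)) volume ∧
    ∫ x, (deriv Ψ (u x) * (Du x ⬝ᵥ G x) + F x * Ψ (u x)) = 0 := by
  obtain ⟨s, hs, hs'⟩ := h.exists_smooth_approx
  set v : ℕ → UnitAddTorus (Fin d) → ℝ := fun k => trigPoly (s k) (coeff u) with hv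
  have hvc : ∀ k, Continuous (v k) := fun k => continuous_trigPoly _ _
  have hΨc : Continuous Ψ := hΨ.continuous
  have hΨc' : Continuous (deriv Ψ) := hΨ.continuous_deriv (by simp)
  have hΨd : Differentiable ℝ Ψ := hΨ.differentiable (by simp)
  have hDG : Integrable (fun x => Du x ⬝ᵥ G x) volume := by
    simp only [dotProduct]
    exact integrable_finsetSum _ fun i _ => (h.memLp_grad i).integrable_mul (hG i)
  have hint : ∀ w : UnitAddTorus (Fin d) → ℝ, AEStronglyMeasurable w volume →
      Integrable (fun x => deriv Ψ (w x) * (Du x ⬝ᵥ G x) + F x * Ψ (w x)) volume := by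
    intro w hw
    refine (hDG.bdd_mul (hΨc'.comp_aestronglyMeasurable hw)
      (ae_of_all _ fun x => hK' (w x))).add ?_
    exact hF.mul_bdd (hΨc.comp_aestronglyMeasurable hw) (ae_of_all _ fun x => hK (w x))
  refine ⟨hint u h.memLp.1, ?_⟩
  have hlim : Tendsto (fun k => ∫ x, (deriv Ψ (v k x) * (Du x ⬝ᵥ G x) + F x * Ψ (v k x)))
      atTop (𝓝 (∫ x, (deriv Ψ (u x) * (Du x ⬝ᵥ G x) + F x * Ψ (u x)))) := by
    -- As `F` is only in `L¹`, the limit rests on almost everywhere convergence and the bounds on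
    -- `Ψ` and `Ψ'`.
    refine tendsto_integral_of_dominated_convergence
      (fun x => K * |Du x ⬝ᵥ G x| + |F x| * K)
      (fun k => (hint (v k) (hvc k).aestronglyMeasurable).1)
      ((hDG.abs.const_mul K).add (hF.abs.mul_const K)) (fun k => ae_of_all _ fun x => ?_) ?_
    · rw [Real.norm_eq_abs]
      refine (abs_add_le _ _).trans ?_
      rw [abs_mul, abs_mul]
      gcongr
      · exact hK' _
      · exact hK _
    · filter_upwards [hs] with x hx
      exact (((hΨc'.tendsto _).comp hx).mul_const _).add (((hΨc.tendsto _).comp hx).const_mul _)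
  have herr := fun i => tendsto_integral_mul_mul_zero (p := fun k x => deriv Ψ (v k x))
    (w := fun k x => partialDeriv i (v k) x - Du x i) (G := fun x => G x i)
    (fun k => (hΨc'.comp (hvc k)).aestronglyMeasurable) (fun k x => hK' (v k x))
    (fun k => MemLp.sub (by rw [hv, partialDeriv_trigPoly]; exact memLp_trigPoly _ _)
      (h.memLp_grad i)) (hs' i) (hG i)
  -- With the errors added back, each term is exactly the equation tested with `Ψ(v_k)`, hence zero.
  have hsum := hlim.add (tendsto_finsetSum Finset.univ fun i _ => (herr i).2)
  simp only [Finset.sum_const_zero, add_zero] at hsum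
  refine tendsto_nhds_unique hsum (tendsto_const_nhds.congr fun k => ?_)
  have hk := heq (fun y => Ψ (v k y)) (hΨ.comp (isSmooth_trigPoly (s k) (coeff u)))
  rw [← integral_finsetSum _ fun i _ => (herr i).1 k,
    ← integral_add (hint (v k) (hvc k).aestronglyMeasurable)
      (integrable_finsetSum _ fun i _ => (herr i).1 k), ← hk]
  refine integral_congr_ae (ae_of_all _ fun x => ?_)
  simp only [dotProduct, Finset.mul_sum]
  rw [add_right_comm, ← Finset.sum_add_distrib]
  congr 1
  refine Finset.sum_congr rfl fun i _ => ?_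
  rw [hv, gradient_comp_trigPoly hΨd]
  ring

/-! ### The cutoff and its logarithmic derivative. -/

/-- A smooth cutoff vanishing exactly on `(-∞, k]`, with logarithmic derivative at least `1 / 2`
on `(k, M]`. -/
def cutoff (k M s : ℝ) : ℝ := Real.smoothTransition (s - k) * Real.sigmoid (s - M)

theorem contDiff_cutoff (k M : ℝ) : ContDiff ℝ ∞ (cutoff k M) := by
  unfold cutoff
  exact (Real.smoothTransition.contDiff.comp (contDiff_id.sub contDiff_const)).mul
    ((contDiff_sigmoid.of_le le_top).comp (contDiff_id.sub contDiff_const))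

theorem cutoff_nonneg (k M s : ℝ) : 0 ≤ cutoff k M s :=
  mul_nonneg (Real.smoothTransition.nonneg _) (Real.sigmoid_nonneg _)

theorem cutoff_of_le {k s : ℝ} (M : ℝ) (h : s ≤ k) : cutoff k M s = 0 := by
  simp [cutoff, Real.smoothTransition.zero_of_nonpos (sub_nonpos.2 h)]

theorem cutoff_pos {k s : ℝ} (M : ℝ) (h : k < s) : 0 < cutoff k M s :=
  mul_pos (Real.smoothTransition.pos_of_pos (sub_pos.2 h)) (Real.sigmoid_pos _)

theorem cutoff_le_one (k M s : ℝ) : cutoff k M s ≤ 1 :=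
  mul_le_one₀ (Real.smoothTransition.le_one _) (Real.sigmoid_nonneg _) (Real.sigmoid_le_one _)

theorem exists_abs_deriv_smoothTransition_le :
    ∃ K : ℝ, ∀ s, |deriv Real.smoothTransition s| ≤ K := by
  have hc : Continuous (deriv Real.smoothTransition) :=
    (Real.smoothTransition.contDiff (n := 1)).continuous_deriv le_rfl
  obtain ⟨K, hK⟩ := (isCompact_Icc (a := (0 : ℝ)) (b := 1)).exists_bound_of_continuousOn
    hc.continuousOn
  have hK0 : 0 ≤ K := (norm_nonneg _).trans (hK 0 (by simp))
  refine ⟨K, fun s => ?_⟩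
  rcases lt_or_ge s 0 with h | h
  · have : Real.smoothTransition =ᶠ[𝓝 s] fun _ => 0 := by
      filter_upwards [Iio_mem_nhds h] with t ht
      exact Real.smoothTransition.zero_of_nonpos (le_of_lt ht)
    rw [this.deriv_eq]
    simpa
  rcases lt_or_ge 1 s with h' | h'
  · have : Real.smoothTransition =ᶠ[𝓝 s] fun _ => 1 := by
      filter_upwards [Ioi_mem_nhds h'] with t ht
      exact Real.smoothTransition.one_of_one_le (le_of_lt ht)
    rw [this.deriv_eq]
    simpa
  · exact hK s ⟨h, h'⟩

theorem deriv_cutoff (k M s : ℝ) : deriv (cutoff k M) s =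
    deriv Real.smoothTransition (s - k) * Real.sigmoid (s - M) +
      cutoff k M s * (1 - Real.sigmoid (s - M)) := by
  have h1 : HasDerivAt (fun t => Real.smoothTransition (t - k))
      (deriv Real.smoothTransition (s - k)) s :=
    (((Real.smoothTransition.contDiff (n := 1)).differentiable (by simp) _).hasDerivAt).comp_sub_const
      s k
  have h2 := (Real.hasDerivAt_sigmoid (s - M)).comp_sub_const s M
  refine (h1.mul h2).deriv.trans ?_
  unfold cutoff
  ring

theorem exists_abs_deriv_cutoff_le (k M : ℝ) : ∃ K : ℝ, ∀ s, |deriv (cutoff k M) s| ≤ K := by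
  obtain ⟨K, hK⟩ := exists_abs_deriv_smoothTransition_le
  refine ⟨K + 1, fun s => ?_⟩
  rw [deriv_cutoff]
  refine (abs_add_le _ _).trans (add_le_add ?_ ?_)
  · rw [abs_mul, abs_of_nonneg (Real.sigmoid_nonneg _)]
    exact (mul_le_of_le_one_right (abs_nonneg _) (Real.sigmoid_le_one _)).trans (hK _)
  · have h1 : 0 ≤ 1 - Real.sigmoid (s - M) := sub_nonneg.2 (Real.sigmoid_le_one _)
    rw [abs_of_nonneg (mul_nonneg (cutoff_nonneg _ _ _) h1)]
    exact mul_le_one₀ (cutoff_le_one _ _ _) h1 (sub_le_self _ (Real.sigmoid_nonneg _))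

/-- The transition is monotone, so its term may be dropped; the logistic identity `σ' = σ (1 - σ)`
gives the rest. -/
theorem mul_cutoff_le_deriv (k M s : ℝ) :
    cutoff k M s * (1 - Real.sigmoid (s - M)) ≤ deriv (cutoff k M) s := by
  rw [deriv_cutoff]
  have := Real.smoothTransition.monotone.deriv_nonneg (x := s - k)
  have := mul_nonneg this (Real.sigmoid_nonneg (s - M))
  linarith

theorem deriv_cutoff_nonneg (k M s : ℝ) : 0 ≤ deriv (cutoff k M) s :=
  (mul_nonneg (cutoff_nonneg _ _ _) (sub_nonneg.2 (Real.sigmoid_le_one _))).trans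
    (mul_cutoff_le_deriv k M s)

theorem half_cutoff_le_deriv {k M s : ℝ} (h : s ≤ M) :
    cutoff k M s / 2 ≤ deriv (cutoff k M) s := by
  refine le_trans ?_ (mul_cutoff_le_deriv k M s)
  have h1 : Real.sigmoid (s - M) ≤ 2⁻¹ := by
    rw [← Real.sigmoid_zero]
    exact Real.sigmoid_le (by linarith)
  rw [div_eq_mul_inv]
  exact mul_le_mul_of_nonneg_left (by linarith) (cutoff_nonneg _ _ _)

/-! ### Bounds on the truncated Hamiltonian. -/

variable {d : ℕ} {A : UnitAddTorus (Fin d) → Matrix (Fin d) (Fin d) ℝ}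

theorem UniformlyElliptic.dotProduct_nonneg (hA : UniformlyElliptic A)
    (x : UnitAddTorus (Fin d)) (p : Fin d → ℝ) : 0 ≤ p ⬝ᵥ (A x *ᵥ p) := by
  obtain ⟨θ₀, _, h0, _, h⟩ := hA
  refine le_trans (mul_nonneg h0.le ?_) (h x p).1
  exact Finset.sum_nonneg fun i _ => mul_self_nonneg _

theorem UniformlyElliptic.heps_nonneg (hA : UniformlyElliptic A) {ε : ℝ} (hε : 0 < ε)
    (x : UnitAddTorus (Fin d)) (p : Fin d → ℝ) : 0 ≤ Heps A ε x p :=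
  div_nonneg (hA.dotProduct_nonneg x p) (by positivity)

theorem UniformlyElliptic.heps_le_half (hA : UniformlyElliptic A) {ε : ℝ} (hε : 0 < ε)
    (x : UnitAddTorus (Fin d)) (p : Fin d → ℝ) :
    Heps A ε x p ≤ (p ⬝ᵥ (A x *ᵥ p)) / 2 :=
  div_le_div_of_nonneg_left (hA.dotProduct_nonneg x p) two_pos
    (le_add_of_nonneg_right (by positivity))

theorem UniformlyElliptic.heps_le_inv (hA : UniformlyElliptic A) {ε : ℝ} (hε : 0 < ε)
    (x : UnitAddTorus (Fin d)) (p : Fin d → ℝ) : Heps A ε x p ≤ ε⁻¹ := by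
  have h := hA.dotProduct_nonneg x p
  rw [Heps, abs_of_nonneg h, div_le_iff₀ (by positivity), mul_add, inv_mul_cancel_left₀ hε.ne']
  exact le_add_of_nonneg_left (by positivity)

theorem UniformlyElliptic.integrable_heps (hA : UniformlyElliptic A) {ε : ℝ} (hε : 0 < ε)
    {p : UnitAddTorus (Fin d) → Fin d → ℝ} (hp : ∀ i, MemLp (fun x => p x i) 2 volume)
    (hAp : ∀ i, MemLp (fun x => (A x *ᵥ p x) i) 2 volume) :
    Integrable (fun x => Heps A ε x (p x)) volume := by
  have hm : AEMeasurable (fun x => p x ⬝ᵥ (A x *ᵥ p x)) volume := by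
    simp only [dotProduct]
    exact Finset.aemeasurable_fun_sum _ fun i _ =>
      (hp i).1.aemeasurable.mul (hAp i).1.aemeasurable
  refine Integrable.of_bound (C := ε⁻¹) ?_ (ae_of_all _ fun x => ?_)
  · have h : Measurable fun t : ℝ => t / (2 + ε * |t|) := by fun_prop
    exact (h.comp_aemeasurable hm).aestronglyMeasurable
  · rw [Real.norm_of_nonneg (hA.heps_nonneg hε x _)]
    exact hA.heps_le_inv hε x _

theorem ae_eq_zero_of_le_of_integral_eq_zero {X : Type*} [MeasurableSpace X] {μ : Measure X}
    {f ψ : X → ℝ} (hf : Integrable f μ) (h0 : ∫ x, f x ∂μ = 0) (hψ : ∀ x, 0 ≤ ψ x)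
    (hle : ∀ x, ψ x ≤ f x) : ∀ᵐ x ∂μ, ψ x = 0 := by
  have h := (integral_eq_zero_iff_of_nonneg (fun x => (hψ x).trans (hle x)) hf).1 h0
  filter_upwards [h] with x hx
  exact le_antisymm ((hle x).trans hx.le) (hψ x)

/-! ### One-sided bounds for solutions. -/

variable {V : UnitAddTorus (Fin d) → ℝ} {g : ℝ → ℝ} {Hbar ε : ℝ}
  {u : UnitAddTorus (Fin d) → ℝ} {k : ℝ}

theorem IsWeakSolution.exists_integral_test_comp (hA : UniformlyElliptic A) (hV : Continuous V)
    (hε : 0 < ε) (hu : IsWeakSolution A V g Hbar ε u) :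
    ∃ p : UnitAddTorus (Fin d) → Fin d → ℝ, ∀ (Ψ : ℝ → ℝ) (K : ℝ), ContDiff ℝ ∞ Ψ →
      (∀ s, |Ψ s| ≤ K) → (∀ s, |deriv Ψ s| ≤ K) →
      Integrable (fun x => deriv Ψ (u x) * (p x ⬝ᵥ (A x *ᵥ p x)) +
        (Heps A ε x (p x) + (V x - Hbar) - g (-u x)) * Ψ (u x)) volume ∧
      ∫ x, (deriv Ψ (u x) * (p x ⬝ᵥ (A x *ᵥ p x)) +
        (Heps A ε x (p x) + (V x - Hbar) - g (-u x)) * Ψ (u x)) = 0 := by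
  obtain ⟨p, hp, hAp, hgi, heq⟩ := hu
  refine ⟨p, fun Ψ K hΨ hK hK' => hp.integral_test_comp hAp ?_ heq hΨ hK hK'⟩
  have hVi : Integrable V volume := hV.integrable_of_hasCompactSupport
    (HasCompactSupport.of_compactSpace V)
  exact ((hA.integrable_heps hε hp.memLp_grad hAp).add (hVi.sub (integrable_const _))).sub hgi

theorem IsWeakSolution.ae_le (hA : UniformlyElliptic A) (hV : Continuous V) (hε : 0 < ε)
    (hu : IsWeakSolution A V g Hbar ε u)
    (hk : ∀ x s, k < s → g (-s) + 1 ≤ V x - Hbar) : ∀ᵐ x, u x ≤ k := by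
  obtain ⟨p, hp⟩ := hu.exists_integral_test_comp hA hV hε
  -- The second parameter is immaterial here: no lower bound on the logarithmic derivative is
  -- needed.
  obtain ⟨K, hK⟩ := exists_abs_deriv_cutoff_le k k
  obtain ⟨hi, h0⟩ := hp (cutoff k k) (max 1 K) (contDiff_cutoff k k)
    (fun s => by
      rw [abs_of_nonneg (cutoff_nonneg k k s)]
      exact (cutoff_le_one k k s).trans (le_max_left _ _))
    (fun s => (hK s).trans (le_max_right _ _))
  have h := ae_eq_zero_of_le_of_integral_eq_zero hi h0
    (fun x => cutoff_nonneg k k (u x)) fun x => ?_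
  · filter_upwards [h] with x hx
    exact le_of_not_gt fun hlt => (cutoff_pos k hlt).ne' hx
  · have h1 := mul_nonneg (deriv_cutoff_nonneg k k (u x)) (hA.dotProduct_nonneg x (p x))
    rcases le_or_gt (u x) k with hle | hlt
    · simpa [cutoff_of_le k hle] using h1
    · have h2 := hk x _ hlt
      have h3 := hA.heps_nonneg hε x (p x)
      have h4 : cutoff k k (u x) ≤
          (Heps A ε x (p x) + (V x - Hbar) - g (-u x)) * cutoff k k (u x) :=
        le_mul_of_one_le_left (cutoff_nonneg _ _ _) (by linarith)
      linarith

theorem IsWeakSolution.neg_le_ae (hA : UniformlyElliptic A) (hV : Continuous V) (hε : 0 < ε)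
    (hu : IsWeakSolution A V g Hbar ε u) (hk : ∀ x s, k < s → V x - Hbar + 1 ≤ g s)
    {M : ℝ} (hM : ∀ x s, M < s → V x - Hbar + 1 + ε⁻¹ ≤ g s) : ∀ᵐ x, -k ≤ u x := by
  obtain ⟨p, hp⟩ := hu.exists_integral_test_comp hA hV hε
  obtain ⟨K, hK⟩ := exists_abs_deriv_cutoff_le k M
  have hd : ∀ s, deriv (fun t => -cutoff k M (-t)) s = deriv (cutoff k M) (-s) := fun s => by
    rw [deriv.fun_neg, deriv_comp_neg, neg_neg]
  obtain ⟨hi, h0⟩ := hp (fun t => -cutoff k M (-t)) (max 1 K)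
    ((contDiff_cutoff k M).comp contDiff_neg).neg
    (fun s => by
      rw [abs_neg, abs_of_nonneg (cutoff_nonneg k M _)]
      exact (cutoff_le_one k M _).trans (le_max_left _ _))
    (fun s => by
      rw [hd]
      exact (hK _).trans (le_max_right _ _))
  have h := ae_eq_zero_of_le_of_integral_eq_zero hi h0
    (fun x => cutoff_nonneg k M (-u x)) fun x => ?_
  · filter_upwards [h] with x hx
    exact neg_le.1 (le_of_not_gt fun hlt => (cutoff_pos M hlt).ne' hx)
  · have ha := hA.dotProduct_nonneg x (p x)
    have h1 := mul_nonneg (deriv_cutoff_nonneg k M (-u x)) ha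
    have hc := cutoff_nonneg k M (-u x)
    rw [hd]
    rcases le_or_gt (-u x) k with hle | hlt
    · simpa [cutoff_of_le M hle] using h1
    -- Up to `M` the diffusion term absorbs `H_ε`; beyond it, the larger lower bound on `g` does.
    · rcases le_or_gt (-u x) M with hle' | hlt'
      · have h2 := mul_le_mul_of_nonneg_right (half_cutoff_le_deriv (k := k) hle') ha
        have h3 := mul_le_mul_of_nonneg_left (hA.heps_le_half hε x (p x)) hc
        have h4 := mul_le_mul_of_nonneg_left (hk x _ hlt) hc
        linarith
      · have h3 := mul_le_mul_of_nonneg_left (hA.heps_le_inv hε x (p x)) hc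
        have h4 := mul_le_mul_of_nonneg_left (hM x _ hlt') hc
        linarith

end EllipticTorus

end


theorem mainTheorem8 (d : ℕ)
    (A : UnitAddTorus (Fin d) → Matrix (Fin d) (Fin d) ℝ)
    (V : UnitAddTorus (Fin d) → ℝ) (g : ℝ → ℝ) (Hbar : ℝ)
    (hA_meas : ∀ i j, Measurable fun x => A x i j)
    (hA : EllipticTorus.UniformlyElliptic A)
    (hV : Continuous V)
    (hg : EllipticTorus.CouplingAssumption g) :
    ∃ C : ℝ≥0, ∀ ε : ℝ, 0 < ε → ∀ u : UnitAddTorus (Fin d) → ℝ,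
      EllipticTorus.IsWeakSolution A V g Hbar ε u →
        eLpNorm u ⊤ volume ≤ (C : ENNReal) := by
  obtain ⟨-, Cg, hCg, hgs⟩ := hg
  obtain ⟨B, hB⟩ := isCompact_univ.exists_bound_of_continuousOn
    (hV.sub (continuous_const (y := Hbar))).continuousOn
  have hB0 : 0 ≤ B := (norm_nonneg _).trans (hB 0 (Set.mem_univ _))
  have hBl : ∀ x, -B ≤ V x - Hbar := fun x => (abs_le.1 (hB x (Set.mem_univ _))).1
  have hBu : ∀ x, V x - Hbar ≤ B := fun x => (abs_le.1 (hB x (Set.mem_univ _))).2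
  have hinv : 0 < 1 / Cg := one_div_pos.2 hCg
  -- Solves `Cg * k - 1 / Cg = B + 1`: above `k` the coupling exceeds `|V - Hbar|` by at least `1`.
  set k : ℝ := (1 / Cg + B + 1) / Cg with hk
  have hk0 : 0 < k := div_pos (by linarith) hCg
  have hCk : Cg * k = 1 / Cg + B + 1 := mul_div_cancel₀ _ hCg.ne'
  have hpos : ∀ s, 0 < s → Cg * s - 1 / Cg ≤ g s := fun s hs => by
    simpa [abs_of_pos hs, Real.sign_of_pos hs] using hgs s
  have hneg : ∀ s, 0 < s → g (-s) ≤ -(Cg * s - 1 / Cg) := fun s hs => by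
    have h := hgs (-s)
    rw [abs_neg, abs_of_pos hs, Real.sign_of_neg (neg_neg_of_pos hs)] at h
    linarith
  refine ⟨k.toNNReal, fun ε hε u hu => ?_⟩
  have hup : ∀ᵐ x, u x ≤ k := hu.ae_le hA hV hε fun x s hs => by
    have h1 := hneg s (hk0.trans hs)
    have h2 := mul_lt_mul_of_pos_left hs hCg
    have h3 := hBl x
    linarith
  have hlow : ∀ᵐ x, -k ≤ u x := by
    have hε' : 0 < ε⁻¹ := inv_pos.2 hε
    -- Raising the level by `ε⁻¹ / Cg` gains the extra `ε⁻¹` required beyond `M`.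
    have hCM : Cg * (k + ε⁻¹ / Cg) = 1 / Cg + B + 1 + ε⁻¹ := by
      rw [mul_add, hCk, mul_div_cancel₀ _ hCg.ne']
    refine hu.neg_le_ae hA hV hε (fun x s hs => ?_) (M := k + ε⁻¹ / Cg) (fun x s hs => ?_)
    · have h1 := hpos s (hk0.trans hs)
      have h2 := mul_lt_mul_of_pos_left hs hCg
      have h3 := hBu x
      linarith
    · have h1 := hpos s ((add_pos hk0 (div_pos hε' hCg)).trans hs)
      have h2 := mul_lt_mul_of_pos_left hs hCg
      have h3 := hBu x
      linarith
  rw [eLpNorm_exponent_top]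
  refine eLpNormEssSup_le_of_ae_bound (C := k) ?_
  filter_upwards [hup, hlow] with x h1 h2
  exact abs_le.2 ⟨h2, h1⟩
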